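/- **Setting.** A pro-$C^*$-algebra $A$ is a complete Hausdorff complex topological $*$-algebra (not necessarily unital) whose topology is determined by the set $S(A)$ of all its continuous $C^*$-seminorms; for $a,b\in A$ we write $a\le b$ if $b-a=c^*c$ for some $c\in A$. A Hilbert $A$-module $E$ is a complex vector space which is also a compatible right $A$-module, equipped with an $A$-valued inner product $\langle\cdot,\cdot\rangle$ that is $\mathbb C$- and $A$-linear in the second variable, with $\langle\xi,\eta\rangle^*=\langle\eta,\xi\rangle$, $\langle\xi,\xi\rangle\ge 0$ and $\langle\xi,\xi\rangle=0\iff\xi=0$, and which is complete with respect to the topology given by the seminorms $\bar p_E(\xi)=\sqrt{p(\langle\xi,\xi\rangle)}$, $p\in S(A)$. In particular $A$ is a Hilbert $A$-module with $\langle a,b\rangle=a^*b$. The bounded part $b(A)=\{a\in A:\ \|a\|_\infty=\sup_{p\in S(A)}p(a)<\infty\}$ is a $C^*$-algebra in the norm $\|\cdot\|_\infty$, and $b(E)=\{\xi\in E:\ \|\xi\|_\infty=\sup_{p\in S(A)}\bar p_E(\xi)<\infty\}$ is a Hilbert $b(A)$-module. The multiplier module $M(E)=L(A,E)$ is the set of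 all adjointable module morphisms $h:A\to E$. For $h\in M(E)$ and $\xi\in E$ put $\langle h,\xi\rangle=h^*(\xi)\in A$ and $\langle\xi,h\rangle=\langle h,\xi\rangle^*$. A sequence $(h_n)_{n}$ in $M(E)$ is a *standard frame of multipliers in $E$* if for every $\xi\in E$ the series $\sum_n\langle\xi,h_n\rangle\langle h_n,\xi\rangle$ converges in $A$ and there are constants $C,D>0$ such that $$C\langle\xi,\xi\rangle\le\sum_n\langle\xi,h_n\rangle\langle h_n,\xi\rangle\le D\langle\xi,\xi\rangle\qquad\text{for all }\xi\in E.$$ The same definitions apply to the Hilbert $b(A)$-module $b(E)$; thus $M(b(E))=L(b(A),b(E))$, and there convergence is in the norm of $b(A)$. **Corollary 3.13.** Let $A$ be a pro-$C^*$-algebra and let $E$ be a Hilbert $A$-module. If $b(E)$ admits a standard frame of multipliers, then $E$ admits a standard frame of multipliers. More precisely, if $(h_n)_n$ is a standard frame of multipliers in $b(E)$, then each $h_n: b(A)\to b(E)$ has a unique extension to an element $\widetilde{h_n}: A\to E$ of $M(E)$, and $(\widetilde{h_n})_n$ is a standard frame of multipliers in $E$. -/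

import Mathlib

open Filter Topology

universe u v

/-- A C*-seminorm on a complex *-algebra: a submultiplicative seminorm `p` with
`p (a* a) = p a ^ 2`. -/
structure CStarSeminorm (A : Type u) [NonUnitalRing A] [StarRing A] [Module ℂ A] extends
    Seminorm ℂ A where
  mul_le' : ∀ a b : A, toFun (a * b) ≤ toFun a * toFun b
  star_mul_self' : ∀ a : A, toFun (star a * a) = toFun a ^ 2

namespace CStarSeminorm

variable {A : Type u} [NonUnitalRing A] [StarRing A] [Module ℂ A]

instance : FunLike (CStarSeminorm A) A ℝ where
  coe p := p.toFun
  coe_injective p q h := by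
    rcases p with ⟨p, _, _⟩; rcases q with ⟨q, _, _⟩
    cases (DFunLike.coe_injective h : p = q)
    rfl

lemma mul_le (p : CStarSeminorm A) (a b : A) : p (a * b) ≤ p a * p b := p.mul_le' a b
lemma star_mul_self (p : CStarSeminorm A) (a : A) : p (star a * a) = p a ^ 2 := p.star_mul_self' a
lemma nonneg (p : CStarSeminorm A) (a : A) : 0 ≤ p a := apply_nonneg p.toSeminorm a

lemma le_star (p : CStarSeminorm A) (a : A) : p a ≤ p (star a) := by
  have h := p.star_mul_self a
  have h2 := p.mul_le (star a) a
  rcases (p.nonneg a).eq_or_lt with h0 | h0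
  · rw [← h0]; exact p.nonneg _
  · nlinarith

lemma star_eq (p : CStarSeminorm A) (a : A) : p (star a) = p a :=
  le_antisymm (by simpa using p.le_star (star a)) (p.le_star a)

end CStarSeminorm

section Embed

/-! Every C*-seminorm is the pullback of the norm of a C*-algebra. This is only used to prove the
Cauchy-Schwarz inequality for inner products with values in a pro-C*-algebra. -/

lemma embed_unital (Y : Type u) [NormedRing Y] [StarRing Y] [CStarRing Y]
    [NormedAlgebra ℂ Y] [StarModule ℂ Y] :
    ∃ (Z : Type u) (_ : CStarAlgebra Z) (φ : Y →⋆ₙₐ[ℂ] Z), ∀ a, ‖φ a‖ = ‖a‖ := by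
  let Z := UniformSpace.Completion Y
  have hiso : Isometry (star : Y → Y) := star_isometry
  let _ : Star Z := ⟨UniformSpace.Completion.map (star : Y → Y)⟩
  have hcont : Continuous (star : Z → Z) := UniformSpace.Completion.continuous_map
  have hcoe : ∀ y : Y, (star (y : Z)) = ((star y : Y) : Z) := fun y =>
    UniformSpace.Completion.map_coe hiso.uniformContinuous y
  let _ : StarRing Z :=
    { star_involutive := fun x => UniformSpace.Completion.induction_on x
        (isClosed_eq (by fun_prop) (by fun_prop)) (fun a => by rw [hcoe, hcoe, star_star])
      star_mul := fun x y => UniformSpace.Completion.induction_on₂ x y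
        (isClosed_eq (by fun_prop) (by fun_prop)) (fun a b => by
          rw [← UniformSpace.Completion.coe_mul, hcoe, hcoe, hcoe, star_mul,
            UniformSpace.Completion.coe_mul])
      star_add := fun x y => UniformSpace.Completion.induction_on₂ x y
        (isClosed_eq (by fun_prop) (by fun_prop)) (fun a b => by
          rw [← UniformSpace.Completion.coe_add, hcoe, hcoe, hcoe, star_add,
            UniformSpace.Completion.coe_add]) }
  let _ : CStarRing Z := ⟨fun x => UniformSpace.Completion.induction_on x
        (isClosed_le (by fun_prop) (by fun_prop)) (fun a => by
          rw [hcoe, ← UniformSpace.Completion.coe_mul, UniformSpace.Completion.norm_coe,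
            UniformSpace.Completion.norm_coe]
          exact CStarRing.norm_mul_self_le a)⟩
  let _ : NormedAlgebra ℂ Z :=
    { (inferInstance : Algebra ℂ Z) with norm_smul_le := norm_smul_le }
  let _ : StarModule ℂ Z := ⟨fun c x => UniformSpace.Completion.induction_on x
        (isClosed_eq (hcont.comp (continuous_const_smul c)) ((continuous_const_smul _).comp hcont))
        (fun a => by
          rw [← UniformSpace.Completion.coe_smul, hcoe, hcoe, star_smul,
            UniformSpace.Completion.coe_smul])⟩
  let _ : CStarAlgebra Z := { }
  refine ⟨Z, inferInstance,
    { toFun := fun a => (a : Z)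
      map_smul' := fun c a => UniformSpace.Completion.coe_smul _ _
      map_zero' := rfl
      map_add' := fun a b => UniformSpace.Completion.coe_add _ _
      map_mul' := fun a b => UniformSpace.Completion.coe_mul _ _
      map_star' := fun a => (hcoe _).symm }, fun a => UniformSpace.Completion.norm_coe a⟩

lemma embed_normed (X : Type u) [NonUnitalNormedRing X] [StarRing X] [CStarRing X]
    [NormedSpace ℂ X] [SMulCommClass ℂ X X] [IsScalarTower ℂ X X] [StarModule ℂ X] :
    ∃ (Z : Type u) (_ : CStarAlgebra Z) (φ : X →⋆ₙₐ[ℂ] Z), ∀ a, ‖φ a‖ = ‖a‖ := by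
  obtain ⟨Z, hZ, φ, hφ⟩ := embed_unital (DoubleCentralizer ℂ X)
  refine ⟨Z, hZ, φ.comp (DoubleCentralizer.coeHom (𝕜 := ℂ) (A := X)), fun a => ?_⟩
  rw [NonUnitalStarAlgHom.comp_apply, hφ, ← DoubleCentralizer.norm_fst]
  exact ContinuousLinearMap.opNorm_mul_apply ℂ X a

open SeparationQuotient in
lemma exists_embed {A : Type u} [NonUnitalRing A] [StarRing A] [Module ℂ A] 
    [IsScalarTower ℂ A A] [SMulCommClass ℂ A A] [StarModule ℂ A] (p : CStarSeminorm A) :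
    ∃ (Z : Type u) (_ : CStarAlgebra Z) (φ : A →⋆ₙₐ[ℂ] Z), ∀ a, ‖φ a‖ = p a := by
  let i1 : SeminormedAddCommGroup A := p.toSeminorm.toSeminormedAddCommGroup
  let i2 : NonUnitalSeminormedRing A :=
    { i1, (inferInstance : NonUnitalRing A) with norm_mul_le := p.mul_le }
  let i3 : NormedSpace ℂ A := ⟨fun c a => (map_smul_eq_mul p.toSeminorm c a).le⟩
  let X := SeparationQuotient A
  have hn : ∀ a : A, ‖a‖ = p a := fun _ => rfl
  have hiso : Isometry (star : A → A) := AddMonoidHomClass.isometry_of_norm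
    (starAddEquiv : A ≃+ A) (fun a => p.star_eq a)
  let : Star X := ⟨SeparationQuotient.lift (fun a => mk (star a)) (fun a b h =>
    mk_eq_mk.2 (h.map hiso.continuous))⟩
  have hs : ∀ a : A, star (mk a : X) = mk (star a) := fun a => rfl
  let : StarRing X :=
    { star_involutive := fun x => by
        obtain ⟨a, rfl⟩ := surjective_mk x
        rw [hs, hs, star_star]
      star_mul := fun x y => by
        obtain ⟨a, rfl⟩ := surjective_mk x
        obtain ⟨b, rfl⟩ := surjective_mk y
        rw [← mk_mul, hs, star_mul, mk_mul]; rfl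
      star_add := fun x y => by
        obtain ⟨a, rfl⟩ := surjective_mk x
        obtain ⟨b, rfl⟩ := surjective_mk y
        rw [← mk_add, hs, star_add, mk_add]; rfl }
  let : CStarRing X := ⟨fun x => by
        obtain ⟨a, rfl⟩ := surjective_mk x
        rw [hs, ← mk_mul, norm_mk, norm_mk, hn, hn, p.star_mul_self, sq]⟩
  let : StarModule ℂ X := ⟨fun c x => by
        obtain ⟨a, rfl⟩ := surjective_mk x
        rw [← mk_smul, hs, star_smul, mk_smul]; rfl⟩
  let : SMulCommClass ℂ X X := ⟨fun c x y => by
        obtain ⟨a, rfl⟩ := surjective_mk x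
        obtain ⟨b, rfl⟩ := surjective_mk y
        exact congrArg mk (mul_smul_comm c a b).symm⟩
  let : IsScalarTower ℂ X X := ⟨fun c x y => by
        obtain ⟨a, rfl⟩ := surjective_mk x
        obtain ⟨b, rfl⟩ := surjective_mk y
        exact congrArg mk (smul_mul_assoc c a b)⟩
  obtain ⟨Z, hZ, φ, hφ⟩ := embed_normed X
  refine ⟨Z, hZ, 
    { toFun := fun a => φ (mk a)
      map_smul' := fun c a => by rw [mk_smul, map_smul]; rfl
      map_zero' := by rw [mk_zero, map_zero]
      map_add' := fun a b => by rw [mk_add, map_add]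
      map_mul' := fun a b => by rw [mk_mul, map_mul]
      map_star' := fun a => by rw [← hs, map_star] }, fun a => ?_⟩
  exact (hφ _).trans (norm_mk a)

end Embed

open scoped RightActions

/-- `S(A)`: the set of all continuous C*-seminorms on `A`. -/
abbrev ContCStarSeminorm (A : Type u) [NonUnitalRing A] [StarRing A] [Module ℂ A]
    [TopologicalSpace A] : Type u :=
  {p : CStarSeminorm A // Continuous p}

/-- A pro-C*-algebra: a complete Hausdorff complex topological *-algebra (not necessarily unital)
whose topology is determined by its continuous C*-seminorms. -/
class ProCStarAlgebra (A : Type u) extends NonUnitalRing A, StarRing A, Module ℂ A,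
    IsScalarTower ℂ A A, SMulCommClass ℂ A A, StarModule ℂ A, UniformSpace A,
    IsUniformAddGroup A, CompleteSpace A, T2Space A where
  withSeminorms : WithSeminorms fun p : ContCStarSeminorm A => p.1.toSeminorm

lemma eq_zero_of_seminorm {A : Type u} [ProCStarAlgebra A] {a : A}
    (h : ∀ p : ContCStarSeminorm A, p.1 a = 0) : a = 0 := by
  by_contra h0
  obtain ⟨p, hp⟩ := ProCStarAlgebra.withSeminorms.separating_of_T1 a h0
  exact hp (h p)

/-- The order of a pro-C*-algebra: `a ≤ b` if `b - a` is positive, i.e. of the form `c* c`. -/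
def CStarLE {A : Type u} [NonUnitalRing A] [StarRing A] (a b : A) : Prop :=
  ∃ c : A, b - a = star c * c

/-- A pre-Hilbert `A`-module: a complex vector space with a compatible right action `ξ <• a` of `A`
and an `A`-valued inner product, linear in the second variable, hermitian, positive and
definite. -/
class PreHilbertModule (A : Type u) (E : Type v) [ProCStarAlgebra A] [AddCommGroup E]
    [Module ℂ E] extends SMul Aᵐᵒᵖ E, Inner A E where
  add_rsmul : ∀ (ξ η : E) (a : A), (ξ + η) <• a = ξ <• a + η <• a
  rsmul_add : ∀ (ξ : E) (a b : A), ξ <• (a + b) = ξ <• a + ξ <• b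
  rsmul_mul : ∀ (ξ : E) (a b : A), ξ <• (a * b) = (ξ <• a) <• b
  smul_rsmul : ∀ (c : ℂ) (ξ : E) (a : A), (c • ξ) <• a = c • (ξ <• a)
  rsmul_smul : ∀ (c : ℂ) (ξ : E) (a : A), ξ <• (c • a) = c • (ξ <• a)
  inner_add_right : ∀ ξ η ζ : E, inner ξ (η + ζ) = inner ξ η + inner ξ ζ
  inner_smul_right : ∀ (c : ℂ) (ξ η : E), inner ξ (c • η) = c • inner ξ η
  inner_rsmul_right : ∀ (ξ η : E) (a : A), inner ξ (η <• a) = inner ξ η * a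
  star_inner : ∀ ξ η : E, star (inner ξ η) = inner η ξ
  inner_self_nonneg : ∀ ξ : E, CStarLE 0 (inner ξ ξ)
  inner_self_eq_zero : ∀ ξ : E, inner ξ ξ = 0 ↔ ξ = 0

namespace PreHilbertModule

variable {A : Type u} {E : Type v} [ProCStarAlgebra A] [AddCommGroup E] [Module ℂ E]
  [PreHilbertModule A E]

lemma inner_add_left (ξ η ζ : E) : inner A (ξ + η) ζ = inner A ξ ζ + inner A η ζ := by
  rw [← star_inner, inner_add_right, star_add, star_inner, star_inner]

lemma inner_smul_left (c : ℂ) (ξ η : E) : inner A (c • ξ) η = star c • inner A ξ η := by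
  rw [← star_inner, inner_smul_right, star_smul, star_inner]

lemma inner_rsmul_left (ξ η : E) (a : A) : inner A (ξ <• a) η = star a * inner A ξ η := by
  rw [← star_inner, inner_rsmul_right, star_mul, star_inner]

lemma inner_zero_right (ξ : E) : inner A ξ (0 : E) = 0 := by
  simpa using inner_smul_right (A := A) 0 ξ 0

/-- The Cauchy-Schwarz inequality `p ⟨ξ, η⟩ ^ 2 ≤ p ⟨ξ, ξ⟩ * p ⟨η, η⟩`. -/
lemma sq_inner_le (p : CStarSeminorm A) (ξ η : E) :
    p (inner A ξ η) ^ 2 ≤ p (inner A ξ ξ) * p (inner A η η) := by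
  obtain ⟨Z, hZ, φ, hφ⟩ := exists_embed p
  let _ : PartialOrder Z := CStarAlgebra.spectralOrder Z
  have _ : StarOrderedRing Z := CStarAlgebra.spectralOrderedRing Z
  set x := φ (inner A ξ ξ) with hx
  set y := φ (inner A η η) with hy
  set z := φ (inner A ξ η) with hz
  rw [← hφ, ← hφ, ← hφ, ← hx, ← hy, ← hz]
  have hzs : φ (inner A η ξ) = star z := by rw [hz, ← map_star, star_inner]
  have hxs : IsSelfAdjoint x := by rw [IsSelfAdjoint, hx, ← map_star, star_inner]
  have key : ∀ t : ℝ, ‖x‖ < t → ‖z‖ ^ 2 ≤ t * ‖y‖ := by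
    intro t ht
    have ht0 : 0 < t := (norm_nonneg x).trans_lt ht
    obtain ⟨d, hd⟩ := inner_self_nonneg (A := A) (ξ <• (inner A ξ η) + (-(t : ℂ)) • η)
    have h1 : 0 ≤ star z * x * z - (2 * t) • (star z * z) + t ^ 2 • y := by
      have h2 : star (φ d) * φ d = star z * x * z - (2 * t) • (star z * z) + t ^ 2 • y := by
        rw [← map_star, ← map_mul, ← hd, sub_zero]
        simp only [inner_add_right, inner_add_left, inner_smul_right, inner_smul_left,
          inner_rsmul_left, inner_rsmul_right, star_inner, map_add, map_smul, map_mul,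
          ← hx, ← hy, ← hz, hzs]
        simp only [← Complex.coe_smul, star_neg, Complex.star_def, Complex.conj_ofReal,
          add_mul, mul_assoc, smul_mul_assoc]
        push_cast
        module
      rw [← h2]; exact star_mul_self_nonneg _
    have h3 : star z * x * z ≤ ‖x‖ • (star z * z) :=
      CStarAlgebra.star_left_conjugate_le_norm_smul
    have h4 : ‖x‖ • (star z * z) ≤ t • (star z * z) :=
      smul_le_smul_of_nonneg_right ht.le (star_mul_self_nonneg _)
    have h5 : t • (star z * z) ≤ t • (t • y) := by
      have h6 := h1.trans (add_le_add_left (sub_le_sub_right (h3.trans h4) _) _)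
      rw [← sub_nonneg]
      convert h6 using 1
      module
    have h7 : star z * z ≤ t • y := (smul_le_smul_iff_of_pos_left ht0).1 h5
    calc ‖z‖ ^ 2 = ‖star z * z‖ := by rw [CStarRing.norm_star_mul_self, sq]
      _ ≤ ‖t • y‖ := CStarAlgebra.norm_le_norm_of_nonneg_of_le (star_mul_self_nonneg _) h7
      _ = t * ‖y‖ := by rw [norm_smul, Real.norm_of_nonneg ht0.le]
  have hlim : Tendsto (fun t : ℝ => t * ‖y‖) (𝓝[>] ‖x‖) (𝓝 (‖x‖ * ‖y‖)) :=
    (tendsto_id.mul_const _).mono_left nhdsWithin_le_nhds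
  exact ge_of_tendsto hlim (eventually_mem_nhdsWithin.mono fun t ht => key t ht)

/-- The seminorm `ξ ↦ √(p ⟨ξ, ξ⟩)` of a pre-Hilbert `A`-module given by a C*-seminorm `p` of `A`. -/
noncomputable def seminorm (E : Type v) [AddCommGroup E] [Module ℂ E] [PreHilbertModule A E]
    (p : CStarSeminorm A) : Seminorm ℂ E :=
  Seminorm.of (fun ξ => √(p (inner A ξ ξ)))
    (fun ξ η => by
      have hcs : ∀ ζ θ : E, p (inner A ζ θ) ≤ √(p (inner A ζ ζ)) * √(p (inner A θ θ)) := by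
        intro ζ θ
        rw [← Real.sqrt_mul (p.nonneg _)]
        exact Real.le_sqrt_of_sq_le (sq_inner_le p ζ θ)
      refine Real.sqrt_le_iff.2 ⟨by positivity, ?_⟩
      rw [inner_add_left, inner_add_right, inner_add_right]
      have h1 := map_add_le_add p.toSeminorm (inner A ξ ξ + inner A ξ η)
        (inner A η ξ + inner A η η)
      have h2 := map_add_le_add p.toSeminorm (inner A ξ ξ) (inner A ξ η)
      have h3 := map_add_le_add p.toSeminorm (inner A η ξ) (inner A η η)
      have h4 := hcs ξ η
      have h5 := hcs η ξ
      have h6 := Real.sq_sqrt (p.nonneg (inner A ξ ξ))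
      have h7 := Real.sq_sqrt (p.nonneg (inner A η η))
      change p _ ≤ p _ + p _ at h1 h2 h3
      nlinarith)
    (fun c ξ => by
      rw [inner_smul_left, inner_smul_right]
      have h1 : p (star c • c • inner A ξ ξ) = ‖c‖ ^ 2 * p (inner A ξ ξ) := by
        have h2 : ∀ (c : ℂ) (a : A), p (c • a) = ‖c‖ * p a := map_smul_eq_mul p.toSeminorm
        rw [h2, h2, norm_star]; ring
      rw [h1, Real.sqrt_mul (by positivity), Real.sqrt_sq (norm_nonneg c)])

end PreHilbertModule

section SupNorm

variable {X : Type v} {ι : Type u} [AddCommGroup X] [Module ℂ X]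

/-- The supremum of a pointwise bounded family of seminorms. -/
noncomputable def supSeminorm [Nonempty ι] (q : ι → Seminorm ℂ X)
    (hq : ∀ x, BddAbove (Set.range fun i => q i x)) : Seminorm ℂ X :=
  Seminorm.of (fun x => ⨆ i, q i x)
    (fun x y => ciSup_le fun i => (map_add_le_add (q i) x y).trans
      (add_le_add (le_ciSup (hq x) i) (le_ciSup (hq y) i)))
    (fun c x => by simp only [map_smul_eq_mul]; exact (Real.mul_iSup_of_nonneg (norm_nonneg c) _).symm)

lemma le_supSeminorm [Nonempty ι] (q : ι → Seminorm ℂ X)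
    (hq : ∀ x, BddAbove (Set.range fun i => q i x)) (i : ι) (x : X) :
    q i x ≤ supSeminorm q hq x := le_ciSup (hq x) i

lemma supSeminorm_le [Nonempty ι] (q : ι → Seminorm ℂ X)
    (hq : ∀ x, BddAbove (Set.range fun i => q i x)) {x : X} {M : ℝ} (h : ∀ i, q i x ≤ M) :
    supSeminorm q hq x ≤ M := ciSup_le h

/-- The normed group whose norm is the supremum of a separating pointwise bounded family of
seminorms. -/
noncomputable abbrev supNormedAddCommGroup [Nonempty ι] (q : ι → Seminorm ℂ X)
    (hq : ∀ x, BddAbove (Set.range fun i => q i x)) (h0 : ∀ x, (∀ i, q i x = 0) → x = 0) :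
    NormedAddCommGroup X :=
  AddGroupNorm.toNormedAddCommGroup
    { (supSeminorm q hq).toAddGroupSeminorm with
      eq_zero_of_map_eq_zero' := fun x hx => h0 x fun i =>
        le_antisymm ((le_supSeminorm q hq i x).trans (le_of_eq hx)) (apply_nonneg _ _) }

/-- A sequence that is Cauchy uniformly in all seminorms converges uniformly in all seminorms. -/
lemma exists_uniform_limit [UniformSpace X] [IsUniformAddGroup X] [CompleteSpace X] [Nonempty ι]
    {q : ι → Seminorm ℂ X} (hq : WithSeminorms q) (u : ℕ → X)
    (hu : ∀ ε > 0, ∃ N, ∀ m ≥ N, ∀ n ≥ N, ∀ i, q i (u m - u n) ≤ ε) :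
    ∃ x, ∀ ε > 0, ∃ N, ∀ n ≥ N, ∀ i, q i (u n - x) ≤ ε := by
  have hc : CauchySeq u := by
    rw [(hq.hasBasis_zero_ball.uniformity_of_nhds_zero).cauchySeq_iff]
    rintro ⟨s, r⟩ hr
    obtain ⟨N, hN⟩ := hu (r / 2) (half_pos hr)
    refine ⟨N, fun m hm n hn => ?_⟩
    rw [Set.mem_ofPred_eq, Seminorm.mem_ball_zero]
    exact Seminorm.finset_sup_apply_lt hr fun i _ => (hN n hn m hm i).trans_lt (half_lt_self hr)
  obtain ⟨x, hx⟩ := cauchySeq_tendsto_of_complete hc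
  refine ⟨x, fun ε hε => ?_⟩
  obtain ⟨N, hN⟩ := hu ε hε
  refine ⟨N, fun n hn i => ?_⟩
  have hlim : Tendsto (fun m => q i (u n - u m)) atTop (𝓝 (q i (u n - x))) :=
    ((hq.continuous_seminorm i).tendsto _).comp (tendsto_const_nhds.sub hx)
  exact le_of_tendsto hlim ((eventually_ge_atTop N).mono fun m hm => hN n hn m hm i)

end SupNorm

/-- A Hilbert `A`-module: a pre-Hilbert `A`-module which is complete for the topology (and the
associated uniformity) determined by the seminorms `ξ ↦ √(p ⟨ξ, ξ⟩)`, `p ∈ S(A)`. -/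
class HilbertModule (A : Type u) (E : Type v) [ProCStarAlgebra A] [AddCommGroup E]
    [Module ℂ E] [UniformSpace E] extends PreHilbertModule A E where
  isUniformAddGroup : IsUniformAddGroup E
  completeSpace : CompleteSpace E
  withSeminorms : WithSeminorms fun p : ContCStarSeminorm A =>
    PreHilbertModule.seminorm E p.1

lemma withSeminorms_of_norm {X : Type v} {ι : Type u} [NormedAddCommGroup X] [NormedSpace ℂ X]
    (q : ι → Seminorm ℂ X) (hq : ∀ i, Continuous (q i)) (i₀ : ι) (h₀ : ∀ x, q i₀ x = ‖x‖) :
    WithSeminorms q := by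
  have : Nonempty ι := ⟨i₀⟩
  rw [SeminormFamily.withSeminorms_iff_nhds_eq_iInf]
  refine le_antisymm (le_iInf fun i => ?_) ((iInf_le _ i₀).trans ?_)
  · rw [← tendsto_iff_comap]
    simpa using (hq i).tendsto 0
  · have h : ⇑(q i₀) = norm := funext h₀
    rw [h, comap_norm_nhds_zero]

/-- The norm of a C*-algebra, as a continuous C*-seminorm. -/
noncomputable def normSeminormC (A : Type u) [NonUnitalCStarAlgebra A] : ContCStarSeminorm A :=
  ⟨{ normSeminorm ℂ A with
      mul_le' := norm_mul_le
      star_mul_self' := fun a => by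
        rw [sq]; exact CStarRing.norm_star_mul_self }, continuous_norm⟩

/-- Every C*-algebra is a pro-C*-algebra. -/
noncomputable instance (priority := 100) NonUnitalCStarAlgebra.toProCStarAlgebra (A : Type u)
    [NonUnitalCStarAlgebra A] : ProCStarAlgebra A where
  withSeminorms := withSeminorms_of_norm _ (fun p => p.2) (normSeminormC A) fun _ => rfl

section BoundedPart

instance (A : Type u) [NonUnitalRing A] [StarRing A] [Module ℂ A]
    [TopologicalSpace A] : Nonempty (ContCStarSeminorm A) :=
  ⟨⟨{ (0 : Seminorm ℂ A) with
      mul_le' := fun _ _ => (mul_zero (0 : ℝ)).ge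
      star_mul_self' := fun _ => (zero_pow two_ne_zero).symm }, continuous_const⟩⟩

variable (A : Type u) [ProCStarAlgebra A]

/-- The *-subalgebra of bounded elements: those `a` with `sup {p a | p ∈ S(A)} < ∞`. -/
def boundedSubalgebra : NonUnitalStarSubalgebra ℂ A where
  carrier := {a | BddAbove (Set.range fun p : ContCStarSeminorm A => p.1 a)}
  add_mem' := by
    rintro a b ⟨M, hM⟩ ⟨N, hN⟩
    refine ⟨M + N, ?_⟩
    rintro _ ⟨p, rfl⟩
    exact (map_add_le_add p.1.toSeminorm a b).trans (add_le_add (hM ⟨p, rfl⟩) (hN ⟨p, rfl⟩))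
  zero_mem' := ⟨0, by rintro _ ⟨p, rfl⟩; exact (map_zero p.1.toSeminorm).le⟩
  mul_mem' := by
    rintro a b ⟨M, hM⟩ ⟨N, hN⟩
    refine ⟨M * N, ?_⟩
    rintro _ ⟨p, rfl⟩
    have h1 : p.1 a ≤ M := hM ⟨p, rfl⟩
    exact (p.1.mul_le a b).trans (mul_le_mul h1 (hN ⟨p, rfl⟩) (p.1.nonneg b)
      ((p.1.nonneg a).trans h1))
  smul_mem' := by
    rintro c a ⟨M, hM⟩
    refine ⟨‖c‖ * M, ?_⟩
    rintro _ ⟨p, rfl⟩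
    exact (map_smul_eq_mul p.1.toSeminorm c a).le.trans
      (mul_le_mul_of_nonneg_left (hM ⟨p, rfl⟩) (norm_nonneg c))
  star_mem' := by
    rintro a ⟨M, hM⟩
    refine ⟨M, ?_⟩
    rintro _ ⟨p, rfl⟩
    exact (p.1.star_eq a).le.trans (hM ⟨p, rfl⟩)

/-- `b(A)`, the bounded part of the pro-C*-algebra `A`. It carries the norm
`‖a‖ = sup {p a | p ∈ S(A)}` and not the topology of `A`, so it is a type of its own. -/
def BoundedPart : Type u := boundedSubalgebra A

namespace BoundedPart

variable {A}

instance : NonUnitalRing (BoundedPart A) := inferInstanceAs (NonUnitalRing (boundedSubalgebra A))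
instance : StarRing (BoundedPart A) := inferInstanceAs (StarRing (boundedSubalgebra A))
instance : Module ℂ (BoundedPart A) := inferInstanceAs (Module ℂ (boundedSubalgebra A))
instance : IsScalarTower ℂ (BoundedPart A) (BoundedPart A) :=
  inferInstanceAs (IsScalarTower ℂ (boundedSubalgebra A) (boundedSubalgebra A))
instance : SMulCommClass ℂ (BoundedPart A) (BoundedPart A) :=
  inferInstanceAs (SMulCommClass ℂ (boundedSubalgebra A) (boundedSubalgebra A))
instance : StarModule ℂ (BoundedPart A) := inferInstanceAs (StarModule ℂ (boundedSubalgebra A))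

/-- The inclusion of `b(A)` into `A`. -/
def incl : BoundedPart A →⋆ₙₐ[ℂ] A := NonUnitalStarSubalgebraClass.subtype (boundedSubalgebra A)

/-- A bounded element of `A`, as an element of `b(A)`. -/
def mk (a : A) (h : BddAbove (Set.range fun p : ContCStarSeminorm A => p.1 a)) : BoundedPart A :=
  ⟨a, h⟩

@[simp] lemma incl_mk (a : A) (h) : incl (mk a h) = a := rfl


lemma incl_injective : Function.Injective (incl : BoundedPart A → A) := Subtype.val_injective

lemma bddAbove (a : BoundedPart A) :
    BddAbove (Set.range fun p : ContCStarSeminorm A => p.1.toSeminorm.comp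
      (incl (A := A) : BoundedPart A →ₗ[ℂ] A) a) := a.2

noncomputable instance : NormedAddCommGroup (BoundedPart A) :=
  supNormedAddCommGroup _ bddAbove fun _ ha =>
    incl_injective ((eq_zero_of_seminorm fun p => ha p).trans (map_zero incl).symm)

lemma norm_eq (a : BoundedPart A) : ‖a‖ = ⨆ p : ContCStarSeminorm A, p.1 (incl a) := rfl

lemma le_norm (p : ContCStarSeminorm A) (a : BoundedPart A) : p.1 (incl a) ≤ ‖a‖ :=
  le_supSeminorm _ bddAbove p a

lemma norm_le {a : BoundedPart A} {M : ℝ} (h : ∀ p : ContCStarSeminorm A, p.1 (incl a) ≤ M) :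
    ‖a‖ ≤ M := supSeminorm_le _ bddAbove h

instance instCompleteSpace : CompleteSpace (BoundedPart A) := by
  refine Metric.complete_of_cauchySeq_tendsto fun u hu => ?_
  rw [Metric.cauchySeq_iff] at hu
  obtain ⟨x, hx⟩ := exists_uniform_limit (ProCStarAlgebra.withSeminorms (A := A))
    (fun n => incl (u n)) (fun ε hε => by
      obtain ⟨N, hN⟩ := hu ε hε
      refine ⟨N, fun m hm n hn p => ?_⟩
      have h := (hN m hm n hn).le
      rw [dist_eq_norm] at h
      exact (map_sub incl (u m) (u n) ▸ le_norm p (u m - u n)).trans h)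
  have hxb : BddAbove (Set.range fun p : ContCStarSeminorm A => p.1 x) := by
    obtain ⟨N, hN⟩ := hx 1 one_pos
    refine ⟨‖u N‖ + 1, ?_⟩
    rintro _ ⟨p, rfl⟩
    have h1 := map_sub_le_add p.1.toSeminorm (incl (u N)) (incl (u N) - x)
    rw [sub_sub_cancel] at h1
    exact h1.trans (add_le_add (le_norm p (u N)) (hN N le_rfl p))
  refine ⟨mk x hxb, ?_⟩
  rw [Metric.tendsto_atTop]
  intro ε hε
  obtain ⟨N, hN⟩ := hx (ε / 2) (half_pos hε)
  refine ⟨N, fun n hn => ?_⟩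
  rw [dist_eq_norm]
  exact (norm_le fun p => by rw [map_sub]; exact hN n hn p).trans_lt (half_lt_self hε)

/-- `b(A)` is a C*-algebra. -/
noncomputable instance : NonUnitalCStarAlgebra (BoundedPart A) :=
  { (inferInstance : NormedAddCommGroup (BoundedPart A)),
    (inferInstance : NonUnitalRing (BoundedPart A)),
    (inferInstance : StarRing (BoundedPart A)),
    (inferInstance : Module ℂ (BoundedPart A)),
    (inferInstance : IsScalarTower ℂ (BoundedPart A) (BoundedPart A)),
    (inferInstance : SMulCommClass ℂ (BoundedPart A) (BoundedPart A)),
    (inferInstance : StarModule ℂ (BoundedPart A)) with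
    norm_mul_le := fun a b => norm_le fun p => by
      rw [map_mul]
      exact (p.1.mul_le _ _).trans
        (mul_le_mul (le_norm p a) (le_norm p b) (p.1.nonneg _) (norm_nonneg a))
    norm_smul_le := fun c a => (map_smul_eq_mul (supSeminorm _ (bddAbove (A := A))) c a).le
    norm_mul_self_le := fun a => by
      have h : ‖a‖ ≤ √‖star a * a‖ := norm_le fun p => by
        refine Real.le_sqrt_of_sq_le ?_
        rw [← p.1.star_mul_self, ← map_star, ← map_mul]
        exact le_norm p _
      have h2 := mul_le_mul h h (norm_nonneg a) (Real.sqrt_nonneg _)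
      rwa [Real.mul_self_sqrt (norm_nonneg _)] at h2 
    complete := instCompleteSpace.complete }

end BoundedPart

/-- `A` is a Hilbert `A`-module with `⟨a, b⟩ = a* b` and the right action by multiplication. -/
instance : HilbertModule A A where
  smul := fun a b => b * a.unop
  inner := fun a b => star a * b
  add_rsmul := fun ξ η a => add_mul ξ η a
  rsmul_add := fun ξ a b => mul_add ξ a b
  rsmul_mul := fun ξ a b => (mul_assoc ξ a b).symm
  smul_rsmul := fun c ξ a => smul_mul_assoc c ξ a
  rsmul_smul := fun c ξ a => mul_smul_comm c ξ a
  inner_add_right := fun ξ η ζ => mul_add (star ξ) η ζ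
  inner_smul_right := fun c ξ η => mul_smul_comm c (star ξ) η
  inner_rsmul_right := fun ξ η a => (mul_assoc (star ξ) η a).symm
  star_inner := fun ξ η => by rw [star_mul, star_star]
  inner_self_nonneg := fun ξ => ⟨ξ, sub_zero _⟩
  inner_self_eq_zero := fun ξ => by
    refine ⟨fun h => eq_zero_of_seminorm fun p => ?_, fun h => by rw [h, mul_zero]⟩
    have h1 := p.1.star_mul_self ξ
    rw [h] at h1
    exact pow_eq_zero_iff two_ne_zero |>.1 (h1.symm.trans (map_zero p.1.toSeminorm))
  isUniformAddGroup := inferInstance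
  completeSpace := inferInstance
  withSeminorms := by
    convert! ProCStarAlgebra.withSeminorms (A := A) using 2 with p
    ext a
    change √(p.1 (star a * a)) = p.1 a
    rw [p.1.star_mul_self, Real.sqrt_sq (p.1.nonneg a)]

lemma ProCStarAlgebra.inner_def (a b : A) : inner A a b = star a * b := rfl
lemma ProCStarAlgebra.rsmul_def (a b : A) : a <• b = a * b := rfl

variable (E : Type v) [AddCommGroup E] [Module ℂ E] [UniformSpace E] [HilbertModule A E]

/-- The subspace of bounded elements: those `ξ` with `sup {√(p ⟨ξ, ξ⟩) | p ∈ S(A)} < ∞`. -/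
def boundedSubmodule : Submodule ℂ E where
  carrier := {ξ | BddAbove
    (Set.range fun p : ContCStarSeminorm A => PreHilbertModule.seminorm E p.1 ξ)}
  add_mem' := by
    rintro a b ⟨M, hM⟩ ⟨N, hN⟩
    refine ⟨M + N, ?_⟩
    rintro _ ⟨p, rfl⟩
    exact (map_add_le_add _ a b).trans (add_le_add (hM ⟨p, rfl⟩) (hN ⟨p, rfl⟩))
  zero_mem' := ⟨0, by rintro _ ⟨p, rfl⟩; exact (map_zero _).le⟩
  smul_mem' := by
    rintro c a ⟨M, hM⟩
    refine ⟨‖c‖ * M, ?_⟩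
    rintro _ ⟨p, rfl⟩
    exact (map_smul_eq_mul _ c a).le.trans
      (mul_le_mul_of_nonneg_left (hM ⟨p, rfl⟩) (norm_nonneg c))

/-- `b(E)`, the bounded part of the Hilbert `A`-module `E`, with the norm
`‖ξ‖ = sup {√(p ⟨ξ, ξ⟩) | p ∈ S(A)}`. -/
def BoundedVec : Type v := boundedSubmodule A E

namespace BoundedVec

variable {A E}

instance : AddCommGroup (BoundedVec A E) := inferInstanceAs (AddCommGroup (boundedSubmodule A E))
instance : Module ℂ (BoundedVec A E) := inferInstanceAs (Module ℂ (boundedSubmodule A E))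

/-- The inclusion of `b(E)` into `E`. -/
def incl : BoundedVec A E →ₗ[ℂ] E := (boundedSubmodule A E).subtype

lemma incl_injective : Function.Injective (incl : BoundedVec A E → E) := Subtype.val_injective

/-- A bounded element of `E`, as an element of `b(E)`. -/
def mk (ξ : E) (h : BddAbove (Set.range fun p : ContCStarSeminorm A =>
    PreHilbertModule.seminorm E p.1 ξ)) : BoundedVec A E := ⟨ξ, h⟩

@[simp] lemma incl_mk (ξ : E) (h) : incl (mk (A := A) ξ h) = ξ := rfl

lemma bddAbove (ξ : BoundedVec A E) :
    BddAbove (Set.range fun p : ContCStarSeminorm A =>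
      (PreHilbertModule.seminorm E p.1).comp (incl (A := A)) ξ) := ξ.2

lemma eq_zero_of_seminorm {ξ : E}
    (h : ∀ p : ContCStarSeminorm A, PreHilbertModule.seminorm E p.1 ξ = 0) : ξ = 0 := by
  rw [← PreHilbertModule.inner_self_eq_zero (A := A)]
  refine _root_.eq_zero_of_seminorm fun p => ?_
  exact (Real.sqrt_eq_zero (p.1.nonneg _)).1 (h p)

noncomputable instance : NormedAddCommGroup (BoundedVec A E) :=
  supNormedAddCommGroup _ bddAbove fun _ ha =>
    incl_injective ((eq_zero_of_seminorm fun p => ha p).trans (map_zero incl).symm)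

noncomputable instance : NormedSpace ℂ (BoundedVec A E) :=
  ⟨fun c a => (map_smul_eq_mul (supSeminorm _ (bddAbove (A := A) (E := E))) c a).le⟩

lemma norm_eq (ξ : BoundedVec A E) :
    ‖ξ‖ = ⨆ p : ContCStarSeminorm A, √(p.1 (inner A (incl ξ) (incl ξ))) := rfl

lemma le_norm (p : ContCStarSeminorm A) (ξ : BoundedVec A E) :
    √(p.1 (inner A (incl ξ) (incl ξ))) ≤ ‖ξ‖ :=
  le_supSeminorm _ bddAbove p ξ

lemma norm_le {ξ : BoundedVec A E} {M : ℝ}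
    (h : ∀ p : ContCStarSeminorm A, √(p.1 (inner A (incl ξ) (incl ξ))) ≤ M) :
    ‖ξ‖ ≤ M := supSeminorm_le _ bddAbove h

instance instCompleteSpace : CompleteSpace (BoundedVec A E) := by
  have _ : IsUniformAddGroup E := HilbertModule.isUniformAddGroup A
  have _ : CompleteSpace E := HilbertModule.completeSpace A
  refine Metric.complete_of_cauchySeq_tendsto fun u hu => ?_
  rw [Metric.cauchySeq_iff] at hu
  obtain ⟨x, hx⟩ := exists_uniform_limit (HilbertModule.withSeminorms (A := A) (E := E))
    (fun n => incl (u n)) (fun ε hε => by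
      obtain ⟨N, hN⟩ := hu ε hε
      refine ⟨N, fun m hm n hn p => ?_⟩
      have h := (hN m hm n hn).le
      rw [dist_eq_norm] at h
      exact (map_sub incl (u m) (u n) ▸ le_norm p (u m - u n)).trans h)
  have hxb : BddAbove (Set.range fun p : ContCStarSeminorm A =>
      PreHilbertModule.seminorm E p.1 x) := by
    obtain ⟨N, hN⟩ := hx 1 one_pos
    refine ⟨‖u N‖ + 1, ?_⟩
    rintro _ ⟨p, rfl⟩
    have h1 := map_sub_le_add (PreHilbertModule.seminorm E p.1) (incl (u N)) (incl (u N) - x)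
    rw [sub_sub_cancel] at h1
    exact h1.trans (add_le_add (le_norm p (u N)) (hN N le_rfl p))
  refine ⟨mk x hxb, ?_⟩
  rw [Metric.tendsto_atTop]
  intro ε hε
  obtain ⟨N, hN⟩ := hx (ε / 2) (half_pos hε)
  refine ⟨N, fun n hn => ?_⟩
  rw [dist_eq_norm]
  exact (norm_le fun p => by rw [map_sub]; exact hN n hn p).trans_lt (half_lt_self hε)

/-- The right action of `A` restricts to a right action of `b(A)` on `b(E)`. -/
instance : SMul (BoundedPart A)ᵐᵒᵖ (BoundedVec A E) :=
  ⟨fun a ξ => mk (incl ξ <• BoundedPart.incl a.unop) ⟨‖a.unop‖ * ‖ξ‖, by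
    rintro _ ⟨p, rfl⟩
    refine Real.sqrt_le_iff.2 ⟨by positivity, ?_⟩
    rw [PreHilbertModule.inner_rsmul_left, PreHilbertModule.inner_rsmul_right]
    have h1 := BoundedPart.le_norm p a.unop
    have h2 := Real.sqrt_le_iff.1 (le_norm p ξ)
    have h3 := p.1.nonneg (BoundedPart.incl a.unop)
    have h4 := p.1.nonneg (inner A (incl ξ) (incl ξ))
    calc _ ≤ p.1 (star (BoundedPart.incl a.unop)) *
            (p.1 (inner A (incl ξ) (incl ξ)) * p.1 (BoundedPart.incl a.unop)) :=
          (p.1.mul_le _ _).trans (mul_le_mul_of_nonneg_left (p.1.mul_le _ _) (p.1.nonneg _))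
      _ = p.1 (BoundedPart.incl a.unop) ^ 2 * p.1 (inner A (incl ξ) (incl ξ)) := by
          rw [p.1.star_eq]; ring
      _ ≤ ‖a.unop‖ ^ 2 * ‖ξ‖ ^ 2 := by gcongr; exact h2.2
      _ = _ := by ring⟩⟩

lemma incl_rsmul (ξ : BoundedVec A E) (a : BoundedPart A) :
    incl (ξ <• a) = incl ξ <• BoundedPart.incl a := rfl

/-- The inner product of `E` restricts to a `b(A)`-valued inner product on `b(E)`. -/
noncomputable instance : Inner (BoundedPart A) (BoundedVec A E) :=
  ⟨fun ξ η => BoundedPart.mk (inner A (incl ξ) (incl η)) ⟨‖ξ‖ * ‖η‖, by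
    rintro _ ⟨p, rfl⟩
    have h1 := le_norm p ξ
    have h2 := le_norm p η
    calc _ ≤ √(p.1 (inner A (incl ξ) (incl ξ))) * √(p.1 (inner A (incl η) (incl η))) := by
          rw [← Real.sqrt_mul (p.1.nonneg _)]
          exact Real.le_sqrt_of_sq_le (PreHilbertModule.sq_inner_le p.1 _ _)
      _ ≤ _ := by gcongr⟩⟩

lemma incl_inner (ξ η : BoundedVec A E) :
    BoundedPart.incl (inner (BoundedPart A) ξ η) = inner A (incl ξ) (incl η) := rfl

noncomputable instance : PreHilbertModule (BoundedPart A) (BoundedVec A E) where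
  add_rsmul := fun ξ η a => incl_injective (by
    simp only [map_add, incl_rsmul, PreHilbertModule.add_rsmul])
  rsmul_add := fun ξ a b => incl_injective (by
    simp only [map_add, incl_rsmul, PreHilbertModule.rsmul_add])
  rsmul_mul := fun ξ a b => incl_injective (by
    simp only [map_mul, incl_rsmul, PreHilbertModule.rsmul_mul])
  smul_rsmul := fun c ξ a => incl_injective (by
    simp only [map_smul, incl_rsmul, PreHilbertModule.smul_rsmul])
  rsmul_smul := fun c ξ a => incl_injective (by
    simp only [map_smul, incl_rsmul, PreHilbertModule.rsmul_smul])
  inner_add_right := fun ξ η ζ => BoundedPart.incl_injective (by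
    simp only [map_add, incl_inner, PreHilbertModule.inner_add_right])
  inner_smul_right := fun c ξ η => BoundedPart.incl_injective (by
    simp only [map_smul, incl_inner, PreHilbertModule.inner_smul_right])
  inner_rsmul_right := fun ξ η a => BoundedPart.incl_injective (by
    simp only [map_mul, incl_inner, incl_rsmul, PreHilbertModule.inner_rsmul_right])
  star_inner := fun ξ η => BoundedPart.incl_injective (by
    simp only [map_star, incl_inner, PreHilbertModule.star_inner])
  inner_self_nonneg := fun ξ => by
    obtain ⟨b, hb⟩ := PreHilbertModule.inner_self_nonneg (A := A) (incl ξ)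
    refine ⟨BoundedPart.mk b ⟨‖ξ‖, ?_⟩, BoundedPart.incl_injective ?_⟩
    · rintro _ ⟨p, rfl⟩
      have h := le_norm p ξ
      rw [← sub_zero (inner A (incl ξ) (incl ξ)), hb, p.1.star_mul_self,
        Real.sqrt_sq (p.1.nonneg b)] at h
      exact h
    · simp only [map_sub, map_zero, map_mul, map_star, incl_inner, hb]
      rfl
  inner_self_eq_zero := fun ξ => by
    rw [← BoundedPart.incl_injective.eq_iff, ← incl_injective.eq_iff, map_zero, map_zero,
      incl_inner, PreHilbertModule.inner_self_eq_zero]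

lemma norm_sq_eq (ξ : BoundedVec A E) : ‖inner (BoundedPart A) ξ ξ‖ = ‖ξ‖ ^ 2 := by
  refine le_antisymm (BoundedPart.norm_le fun p => ?_) ?_
  · exact (Real.sqrt_le_iff.1 (le_norm p ξ)).2
  · have h : ‖ξ‖ ≤ √‖inner (BoundedPart A) ξ ξ‖ := norm_le fun p =>
      Real.sqrt_le_sqrt (BoundedPart.le_norm p (inner (BoundedPart A) ξ ξ))
    exact (Real.le_sqrt (norm_nonneg _) (norm_nonneg _)).1 h

/-- `b(E)` is a Hilbert `b(A)`-module. -/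
noncomputable instance : HilbertModule (BoundedPart A) (BoundedVec A E) where
  isUniformAddGroup := inferInstance
  completeSpace := inferInstance
  withSeminorms := by
    refine withSeminorms_of_norm _ (fun P => ?_) (normSeminormC _) fun ξ => ?_
    · refine Seminorm.continuous_of_continuousAt_zero ?_
      rw [ContinuousAt, map_zero]
      have h1 : Tendsto (fun ξ : BoundedVec A E => inner (BoundedPart A) ξ ξ) (𝓝 0) (𝓝 0) := by
        rw [tendsto_zero_iff_norm_tendsto_zero]
        simp only [norm_sq_eq]
        have h0 : Continuous fun ξ : BoundedVec A E => ‖ξ‖ ^ 2 := by fun_prop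
        simpa using h0.tendsto 0
      have h2 : Tendsto (fun a : BoundedPart A => √(P.1 a)) (𝓝 0) (𝓝 0) := by
        have h3 := (Real.continuous_sqrt.comp P.2).tendsto 0
        have h4 : P.1 0 = 0 := map_zero P.1.toSeminorm
        rw [Function.comp_apply, h4, Real.sqrt_zero] at h3
        exact h3
      exact h2.comp h1
    · change √‖inner (BoundedPart A) ξ ξ‖ = ‖ξ‖
      rw [norm_sq_eq, Real.sqrt_sq (norm_nonneg _)]

end BoundedVec

end BoundedPart

section Frames

/-- `L(E, F)`: the adjointable module morphisms, i.e. the module morphisms `T : E → F` for which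
there is a module morphism `S : F → E` with `⟨T ξ, η⟩ = ⟨ξ, S η⟩`. -/
structure AdjointableMap (A : Type u) [ProCStarAlgebra A] (E F : Type*)
    [AddCommGroup E] [Module ℂ E] [PreHilbertModule A E]
    [AddCommGroup F] [Module ℂ F] [PreHilbertModule A F] extends E →ₗ[ℂ] F where
  map_rsmul' : ∀ (ξ : E) (a : A), toFun (ξ <• a) = toFun ξ <• a
  exists_adjoint' : ∃ S : F →ₗ[ℂ] E, (∀ (η : F) (a : A), S (η <• a) = S η <• a) ∧
    ∀ (ξ : E) (η : F), inner A (toFun ξ) η = inner A ξ (S η)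

namespace AdjointableMap

variable {A : Type u} [ProCStarAlgebra A] {E F : Type*}
  [AddCommGroup E] [Module ℂ E] [PreHilbertModule A E]
  [AddCommGroup F] [Module ℂ F] [PreHilbertModule A F]

instance : CoeFun (AdjointableMap A E F) fun _ => E → F := ⟨fun T => T.toFun⟩

/-- The adjoint `T*`; it is unique because the inner product is definite. -/
noncomputable def adjoint (T : AdjointableMap A E F) : AdjointableMap A F E where
  toLinearMap := T.exists_adjoint'.choose
  map_rsmul' := T.exists_adjoint'.choose_spec.1
  exists_adjoint' := ⟨T.toLinearMap, T.map_rsmul', fun η ξ => by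
    rw [← PreHilbertModule.star_inner]
    refine (congrArg star (T.exists_adjoint'.choose_spec.2 ξ η).symm).trans ?_
    exact PreHilbertModule.star_inner _ _⟩

lemma inner_map (T : AdjointableMap A E F) (ξ : E) (η : F) :
    inner A (T ξ) η = inner A ξ (T.adjoint η) := T.exists_adjoint'.choose_spec.2 ξ η

end AdjointableMap

/-- The multiplier module `M(E) = L(A, E)` of `E`. -/
abbrev Multiplier (A : Type u) [ProCStarAlgebra A] (E : Type*) [AddCommGroup E] [Module ℂ E]
    [PreHilbertModule A E] := AdjointableMap A A E

namespace Multiplier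

variable {A : Type u} [ProCStarAlgebra A] {E : Type*} [AddCommGroup E] [Module ℂ E]
  [PreHilbertModule A E]

/-- The embedding of `E` into `M(E)` which sends `ξ` to the multiplier `a ↦ ξ <• a`. -/
def ofVec (ξ : E) : Multiplier A E where
  toFun := fun a => ξ <• a
  map_add' := fun a b => PreHilbertModule.rsmul_add ξ a b
  map_smul' := fun c a => PreHilbertModule.rsmul_smul c ξ a
  map_rsmul' := fun a b => PreHilbertModule.rsmul_mul ξ a b
  exists_adjoint' := ⟨
    { toFun := fun η => inner A ξ η
      map_add' := fun η ζ => PreHilbertModule.inner_add_right ξ η ζ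
      map_smul' := fun c η => PreHilbertModule.inner_smul_right c ξ η },
    fun η a => PreHilbertModule.inner_rsmul_right ξ η a,
    fun a η => PreHilbertModule.inner_rsmul_left ξ η a⟩

/-- The inner product `⟨h, ξ⟩ = h* ξ ∈ A` of a multiplier `h` of `E` with an element `ξ` of `E`.
The inner product `⟨ξ, h⟩` is its adjoint `star (pairing h ξ)`. -/
noncomputable def pairing (h : Multiplier A E) (ξ : E) : A := h.adjoint ξ

/-- The inner product `h* ∘ k ∈ L(A)` of multipliers, taken at `k = ofVec ξ`, is the left
multiplication by `pairing h ξ`. -/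
lemma adjoint_ofVec (h : Multiplier A E) (ξ : E) (a : A) :
    h.adjoint (ofVec ξ a) = h.pairing ξ * a := h.adjoint.map_rsmul' ξ a

end Multiplier

/-- A sequence of multipliers `h n ∈ M(E)` is a standard frame of multipliers in `E` if for every
`ξ ∈ E` the series `∑ ⟨ξ, h n⟩ ⟨h n, ξ⟩` converges in `A`, and if there are constants `C, D > 0`
with `C ⟨ξ, ξ⟩ ≤ ∑ ⟨ξ, h n⟩ ⟨h n, ξ⟩ ≤ D ⟨ξ, ξ⟩` for all `ξ ∈ E`. -/
def IsStandardFrame {A : Type u} [ProCStarAlgebra A] {E : Type*} [AddCommGroup E]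
    [Module ℂ E] [PreHilbertModule A E] (h : ℕ → Multiplier A E) : Prop :=
  ∃ S : E → A,
    (∀ ξ, Tendsto (fun N => ∑ n ∈ Finset.range N, star ((h n).pairing ξ) * (h n).pairing ξ) atTop
      (𝓝 (S ξ))) ∧
    ∃ C D : ℝ, 0 < C ∧ 0 < D ∧
      ∀ ξ, CStarLE ((C : ℂ) • inner A ξ ξ) (S ξ) ∧ CStarLE (S ξ) ((D : ℂ) • inner A ξ ξ)

/-- The multiplier `k : A → E` of `E` extends the multiplier `h : b(A) → b(E)` of `b(E)`. -/
def Multiplier.Extends {A : Type u} [ProCStarAlgebra A] {E : Type v} [AddCommGroup E]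
    [Module ℂ E] [UniformSpace E] [HilbertModule A E] (k : Multiplier A E)
    (h : Multiplier (BoundedPart A) (BoundedVec A E)) : Prop :=
  ∀ a : BoundedPart A, k (BoundedPart.incl a) = BoundedVec.incl (h a)

end Frames

/-! The bounded part is large in an algebraic sense: every `ξ` in `E` factors as `ξ = η (1 + b)`
with `η` bounded and `b` in `A`. With `x = ⟨ξ, ξ⟩`, one takes `b = x` and `η = ξ (1 + x)⁻¹`. As `A`
need not have a unit, `(1 + x)⁻¹` is written `1 + d`, where `d` is a quasi-inverse of `x`
(`exists_quasiInverse`). Then `⟨η, η⟩ = -d - d²`, and `d` is bounded uniformly over all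
C*-seminorms, so `η` is bounded (`exists_eq_add_rsmul`). Taking `E = A` gives the same factorisation
in `A`.

Everything else is transported along the factor `1 + b`. A module map is determined by its values on
bounded elements, so extensions are unique. Existence comes from sending `a (1 + b)` to `h(a) (1 +
b)`. This does not depend on the factorisation, since its inner products with bounded vectors do not
and these vectors separate the points of `E` (`ext_inner_incl`, `exists_extends`).

For `ξ = η (1 + b)`, the inner product `⟨ξ, ξ⟩` and the partial sums of the frame series are the
conjugates `(1 + b)* · (1 + b)` of those for `η`. Conjugation preserves limits and the order, so the
frame inequalities pass from `η` to `ξ` with the same constants (`IsStandardFrame.of_extends`). -/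

section CStar

/-! ### Norm estimates for `1 + c* c` in a unital C*-algebra. -/

variable {Z : Type u} [CStarAlgebra Z]

/-- For `w = (1 + c* c) z`, expanding `w* w` gives `z* z` plus three positive terms. The estimate
makes approximate quasi-inverses Cauchy once their residuals tend to zero, and bounds `(1 + c* c)⁻¹`
by 1. -/
lemma CStarAlgebra.norm_le_norm_add_star_mul_self_mul (c z : Z) :
    ‖z‖ ≤ ‖z + star c * c * z‖ := by
  let _ : PartialOrder Z := CStarAlgebra.spectralOrder Z
  have _ : StarOrderedRing Z := CStarAlgebra.spectralOrderedRing Z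
  set w := z + star c * c * z with hw
  have h1 : star w * w = star z * z + (star (c * z) * (c * z) + star (c * z) * (c * z)
      + star (star c * c * z) * (star c * c * z)) := by
    simp only [hw, star_add, star_mul, star_star]
    noncomm_ring
  have h2 : star z * z ≤ star w * w := by
    rw [h1]
    exact le_add_of_nonneg_right (add_nonneg (add_nonneg (star_mul_self_nonneg _)
      (star_mul_self_nonneg _)) (star_mul_self_nonneg _))
  have h3 := CStarAlgebra.norm_le_norm_of_nonneg_of_le (star_mul_self_nonneg z) h2
  rw [CStarRing.norm_star_mul_self, CStarRing.norm_star_mul_self] at h3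
  exact (mul_self_le_mul_self_iff (norm_nonneg _) (norm_nonneg _)).2 h3

/-- The hypothesis on `ε` makes `1 - ε (1 + c* c)` positive, and it is at most `1 - ε`. Hence its
norm is at most `1 - ε`. -/
lemma CStarAlgebra.norm_sub_smul_add_star_mul_self_mul_le (c z : Z) {ε : ℝ} (h0 : 0 ≤ ε)
    (h : ε * (1 + ‖star c * c‖) ≤ 1) :
    ‖z - ε • (z + star c * c * z)‖ ≤ (1 - ε) * ‖z‖ := by
  let _ : PartialOrder Z := CStarAlgebra.spectralOrder Z
  have _ : StarOrderedRing Z := CStarAlgebra.spectralOrderedRing Z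
  have hε : 0 ≤ 1 - ε := by nlinarith [norm_nonneg (star c * c)]
  have hx : star c * c ≤ algebraMap ℝ Z ‖star c * c‖ :=
    IsSelfAdjoint.le_algebraMap_norm_self (IsSelfAdjoint.star_mul_self c)
  have h1 : ‖algebraMap ℝ Z (1 - ε) - ε • (star c * c)‖ ≤ 1 - ε := by
    refine (CStarAlgebra.norm_le_iff_le_algebraMap _ hε ?_).2
      (sub_le_self _ (smul_nonneg h0 (star_mul_self_nonneg c)))
    · rw [sub_nonneg]
      refine (smul_le_smul_of_nonneg_left hx h0).trans ?_
      rw [Algebra.smul_def, ← map_mul]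
      exact algebraMap_mono Z (by linarith)
  have h2 : z - ε • (z + star c * c * z) =
      (algebraMap ℝ Z (1 - ε) - ε • (star c * c)) * z := by
    rw [sub_mul, map_sub, map_one, sub_mul, one_mul, ← Algebra.smul_def, smul_mul_assoc, smul_add]
    abel
  rw [h2]
  exact (norm_mul_le _ _).trans (mul_le_mul_of_nonneg_right h1 (norm_nonneg _))

/-- The equation says `(1 + c* c) (1 + d) = 1`, so `‖1 + d‖ ≤ 1`. What matters later is that the
bound does not depend on `c`. -/
lemma CStarAlgebra.norm_le_two_of_quasiInverse (c d : Z)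
    (h : star c * c + d + star c * c * d = 0) : ‖d‖ ≤ 2 := by
  have h1 := CStarAlgebra.norm_le_norm_add_star_mul_self_mul c (1 + d)
  have h2 : 1 + d + star c * c * (1 + d) = 1 := by
    rw [mul_add, mul_one]
    calc _ = 1 + (star c * c + d + star c * c * d) := by abel
      _ = 1 := by rw [h, add_zero]
  have h3 : ‖(1 : Z)‖ ≤ 1 := by
    rcases subsingleton_or_nontrivial Z with _ | _
    · rw [Subsingleton.elim (1 : Z) 0, norm_zero]; exact zero_le_one
    · exact CStarRing.norm_one.le
  rw [h2] at h1
  calc ‖d‖ = ‖(1 + d) - 1‖ := by rw [add_sub_cancel_left]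
    _ ≤ ‖1 + d‖ + ‖(1 : Z)‖ := norm_sub_le _ _
    _ ≤ 2 := by linarith

end CStar

/-- The factors `1 - 1/(n+2) = (n+1)/(n+2)` telescope: `(n + 1) * r n` is eventually nonincreasing,
so `r n = O(1/n)`. -/
lemma tendsto_zero_of_eventually_contracting {r : ℕ → ℝ} (h0 : ∀ n, 0 ≤ r n)
    (h : ∀ᶠ n : ℕ in atTop, r (n + 1) ≤ (1 - 1 / ((n : ℝ) + 2)) * r n) :
    Tendsto r atTop (𝓝 0) := by
  obtain ⟨N, hN⟩ := eventually_atTop.1 h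
  have h1 : ∀ n ≥ N, ((n : ℝ) + 1) * r n ≤ ((N : ℝ) + 1) * r N := by
    intro n hn
    induction n, hn using Nat.le_induction with
    | base => exact le_rfl
    | succ n hn ih =>
      refine le_trans ?_ ih
      have h2 := mul_le_mul_of_nonneg_left (hN n hn) (by positivity : (0 : ℝ) ≤ (n : ℝ) + 2)
      push_cast
      calc ((n : ℝ) + 1 + 1) * r (n + 1) = ((n : ℝ) + 2) * r (n + 1) := by ring
        _ ≤ _ := h2
        _ = _ := by field_simp; ring
  have h3 : Tendsto (fun n : ℕ => ((N : ℝ) + 1) * r N * (1 / ((n : ℝ) + 1))) atTop (𝓝 0) := by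
    simpa using (tendsto_one_div_add_atTop_nhds_zero_nat (𝕜 := ℝ)).const_mul (((N : ℝ) + 1) * r N)
  refine squeeze_zero' (Eventually.of_forall h0) ((eventually_ge_atTop N).mono fun n hn => ?_) h3
  rw [mul_one_div, le_div_iff₀ (by positivity), mul_comm]
  exact h1 n hn

namespace CStarSeminorm

variable {A : Type u} [NonUnitalRing A] [StarRing A] [Module ℂ A]

lemma map_sub_le (p : CStarSeminorm A) (a b : A) : p (a - b) ≤ p a + p b :=
  map_sub_le_add p.toSeminorm a b

end CStarSeminorm

/-! ### Convergence and quasi-inverses in a pro-C*-algebra. -/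

namespace ProCStarAlgebra

variable {A : Type u} [ProCStarAlgebra A]

lemma tendsto_iff {ι : Type*} {l : Filter ι} {u : ι → A} {a : A} :
    Tendsto u l (𝓝 a) ↔
      ∀ p : ContCStarSeminorm A, Tendsto (fun i => p.1 (u i - a)) l (𝓝 0) := by
  rw [withSeminorms.tendsto_nhds]
  refine forall_congr' fun p => ?_
  rw [Metric.tendsto_nhds]
  refine forall₂_congr fun ε _ => eventually_congr (Eventually.of_forall fun i => ?_)
  rw [dist_zero_right, Real.norm_of_nonneg (p.1.nonneg _)]
  rfl

lemma tendsto_mul_left (x : A) {ι : Type*} {l : Filter ι} {u : ι → A} {a : A}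
    (h : Tendsto u l (𝓝 a)) : Tendsto (fun i => x * u i) l (𝓝 (x * a)) := by
  rw [tendsto_iff] at h ⊢
  refine fun p => squeeze_zero (fun i => p.1.nonneg _) (fun i => ?_)
    (by simpa using (h p).const_mul (p.1 x))
  rw [← mul_sub]
  exact p.1.mul_le _ _

lemma tendsto_mul_right (x : A) {ι : Type*} {l : Filter ι} {u : ι → A} {a : A}
    (h : Tendsto u l (𝓝 a)) : Tendsto (fun i => u i * x) l (𝓝 (a * x)) := by
  rw [tendsto_iff] at h ⊢
  refine fun p => squeeze_zero (fun i => p.1.nonneg _) (fun i => ?_)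
    (by simpa using (h p).mul_const (p.1 x))
  rw [← sub_mul]
  exact p.1.mul_le _ _

lemma exists_tendsto_of_cauchy {u : ℕ → A}
    (h : ∀ p : ContCStarSeminorm A,
      Tendsto (fun m : ℕ × ℕ => p.1 (u m.2 - u m.1)) atTop (𝓝 0)) :
    ∃ a, Tendsto u atTop (𝓝 a) := by
  refine cauchySeq_tendsto_of_complete (cauchySeq_iff_tendsto.2 ?_)
  rw [uniformity_eq_comap_nhds_zero, tendsto_comap_iff, tendsto_iff]
  intro p
  simpa using h p

/-- Approximations of the quasi-inverse of `x`, with residuals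
`x + d n + x * d n` multiplied by `1 - (1 + x) / (n + 2)` in each step. -/
noncomputable def quasiInverseSeq (x : A) : ℕ → A
  | 0 => 0
  | n + 1 => quasiInverseSeq x n - ((1 / ((n : ℝ) + 2) : ℝ) : ℂ) •
      (x + quasiInverseSeq x n + x * quasiInverseSeq x n)

/-- A positive element `x` has a quasi-inverse `d`, i.e. formally `(1 + x) * (1 + d) = 1`. -/
lemma exists_quasiInverse (c : A) :
    ∃ d : A, star c * c + d + star c * c * d = 0 ∧ star d = d ∧
      ∀ p : CStarSeminorm A, p d ≤ 2 := by
  set x := star c * c with hx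
  set d := quasiInverseSeq x with hd
  obtain ⟨r, hr⟩ : ∃ r : ℕ → A, ∀ n, r n = x + d n + x * d n := ⟨_, fun _ => rfl⟩
  have hdr : ∀ n, d (n + 1) = d n - ((1 / ((n : ℝ) + 2) : ℝ) : ℂ) • r n := fun n => by
    rw [hr]; rfl
  have hrr : ∀ n, r (n + 1) = r n - ((1 / ((n : ℝ) + 2) : ℝ) : ℂ) • (r n + x * r n) := by
    intro n
    rw [hr (n + 1), hdr, mul_sub, mul_smul_comm, smul_add]
    nth_rewrite 3 [hr]
    abel
  have hr0 : ∀ p : ContCStarSeminorm A, Tendsto (fun n => p.1 (r n)) atTop (𝓝 0) := by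
    intro p
    obtain ⟨Z, hZ, φ, hφ⟩ := exists_embed p.1
    refine tendsto_zero_of_eventually_contracting (fun n => p.1.nonneg _) ?_
    -- Since `p x` may be unbounded in `p`, no constant step size need suit all seminorms. The steps
    -- `1/(n+2)` become small enough for each `p`, while their sum diverges, which drives the
    -- residuals to zero.
    have hev : ∀ᶠ n : ℕ in atTop, 1 + p.1 x ≤ (n : ℝ) :=
      tendsto_natCast_atTop_atTop.eventually_ge_atTop _
    refine hev.mono fun n hn => ?_
    have h1 := CStarAlgebra.norm_sub_smul_add_star_mul_self_mul_le (φ c) (φ (r n))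
      (ε := 1 / ((n : ℝ) + 2)) (by positivity) (by
        rw [← map_star, ← map_mul, hφ, one_div_mul_eq_div, div_le_one (by positivity)]
        linarith)
    rw [← hφ, ← hφ, hrr, map_sub, map_smul, map_add, map_mul φ x, hx, map_mul φ (star c), map_star,
      Complex.coe_smul]
    exact h1
  obtain ⟨e, he⟩ := exists_tendsto_of_cauchy (u := d) (fun p => by
    obtain ⟨Z, hZ, φ, hφ⟩ := exists_embed p.1
    have h1 : Tendsto (fun m : ℕ × ℕ => p.1 (r m.2) + p.1 (r m.1)) atTop (𝓝 0) := by
      rw [← prod_atTop_atTop_eq]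
      simpa using ((hr0 p).comp tendsto_snd).add ((hr0 p).comp tendsto_fst)
    refine squeeze_zero (fun m => p.1.nonneg _) (fun m => ?_) h1
    refine le_trans ?_ (p.1.map_sub_le _ _)
    have h2 := CStarAlgebra.norm_le_norm_add_star_mul_self_mul (φ c) (φ (d m.2 - d m.1))
    -- Differences of residuals are `(1 + x)` times differences of the `d n`, and `1 + x` does not
    -- decrease norms.
    rw [← map_star, ← map_mul, ← map_mul, ← map_add, hφ, hφ] at h2
    refine h2.trans (le_of_eq (congrArg p.1 ?_))
    rw [← hx, mul_sub, hr, hr]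
    abel)
  have hre : x + e + x * e = 0 :=
    tendsto_nhds_unique ((tendsto_const_nhds.add he).add (tendsto_mul_left x he))
      (tendsto_iff.2 fun p => by simpa [hr] using hr0 p)
  have hre2 : x + star e + star e * x = 0 := by
    have h := congrArg star hre
    simpa [hx] using h
  refine ⟨e, hre, ?_, fun p => ?_⟩
  -- `1 + e` is a right inverse of `1 + x` and `1 + star e` a left inverse, so the usual argument
  -- identifies them.
  · have h1 : star e * x = x * e := by
      have h2 : star e * (x + e + x * e) - (x + star e + star e * x) * e = 0 := by
        rw [hre, hre2, mul_zero, zero_mul, sub_zero]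
      rw [← sub_eq_zero, ← h2]
      noncomm_ring
    rw [h1] at hre2
    have h3 := hre2.trans hre.symm
    simpa using h3
  · obtain ⟨Z, hZ, φ, hφ⟩ := exists_embed p
    rw [← hφ]
    refine CStarAlgebra.norm_le_two_of_quasiInverse (φ c) (φ e) ?_
    rw [← map_star, ← map_mul, ← map_mul, ← map_add, ← map_add, hre, map_zero]

end ProCStarAlgebra

/-! ### Order and morphism preliminaries. -/

/-- This is conjugation by the formal element `1 + b`, written without a unit: if `y - x = c* c`,
the witness becomes `c (1 + b)`. -/
lemma CStarLE.conj {A : Type u} [NonUnitalRing A] [StarRing A] {x y : A} (h : CStarLE x y)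
    (b : A) : CStarLE (x + x * b + star b * (x + x * b)) (y + y * b + star b * (y + y * b)) := by
  obtain ⟨c, hc⟩ := h
  refine ⟨c + c * b, ?_⟩
  rw [sub_eq_iff_eq_add] at hc
  simp only [hc, star_add, star_mul]
  noncomm_ring

lemma CStarLE.map {A B : Type*} [NonUnitalRing A] [StarRing A] [Module ℂ A] [NonUnitalRing B]
    [StarRing B] [Module ℂ B] (φ : A →⋆ₙₐ[ℂ] B) {x y : A} (h : CStarLE x y) :
    CStarLE (φ x) (φ y) := by
  obtain ⟨c, hc⟩ := h
  exact ⟨φ c, by rw [← map_sub, hc, map_mul, map_star]⟩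

namespace AdjointableMap

variable {A : Type u} [ProCStarAlgebra A] {E F : Type*}
  [AddCommGroup E] [Module ℂ E] [PreHilbertModule A E]
  [AddCommGroup F] [Module ℂ F] [PreHilbertModule A F]

lemma ext {S T : AdjointableMap A E F} (h : ∀ ξ, S ξ = T ξ) : S = T := by
  rcases S with ⟨S, _, _⟩
  rcases T with ⟨T, _, _⟩
  have : S = T := LinearMap.ext h
  subst this
  rfl

lemma map_rsmul (T : AdjointableMap A E F) (ξ : E) (a : A) : T (ξ <• a) = T ξ <• a :=
  T.map_rsmul' ξ a

lemma map_add (T : AdjointableMap A E F) (ξ η : E) : T (ξ + η) = T ξ + T η :=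
  T.toLinearMap.map_add ξ η

lemma map_add_rsmul (T : AdjointableMap A E F) (ξ : E) (a : A) :
    T (ξ + ξ <• a) = T ξ + T ξ <• a := by
  rw [map_add, map_rsmul]

end AdjointableMap

lemma PreHilbertModule.inner_sub_right {A : Type u} {E : Type v} [ProCStarAlgebra A]
    [AddCommGroup E] [Module ℂ E] [PreHilbertModule A E] (ξ η ζ : E) :
    inner A ξ (η - ζ) = inner A ξ η - inner A ξ ζ := by
  rw [eq_sub_iff_add_eq, ← inner_add_right, sub_add_cancel]

/-! ### Factorisation of arbitrary elements through bounded ones. -/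

namespace BoundedVec

variable {A : Type u} {E : Type v} [ProCStarAlgebra A] [AddCommGroup E] [Module ℂ E]
  [UniformSpace E] [HilbertModule A E]

open PreHilbertModule in
/-- Every element of `E` is of the form `η (1 + b)` with `η` bounded. -/
lemma exists_eq_add_rsmul (ξ : E) :
    ∃ (η : BoundedVec A E) (b : A), ξ = incl η + incl η <• b := by
  obtain ⟨c, hc⟩ := inner_self_nonneg (A := A) ξ
  rw [sub_zero] at hc
  obtain ⟨d, hd, hds, hd2⟩ := ProCStarAlgebra.exists_quasiInverse c
  rw [← hc] at hd
  have hd' : inner A ξ ξ + d + d * inner A ξ ξ = 0 := by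
    simpa [hds, star_inner] using congrArg star hd
  have hbdd : BddAbove (Set.range fun p : ContCStarSeminorm A =>
      seminorm E p.1 (ξ + ξ <• d)) := by
    -- The inner square of `ξ (1 + d)` is `-d - d²`, and `p d ≤ 2` gives `2 + 2² = 6` for every `p`.
    refine ⟨√6, ?_⟩
    rintro _ ⟨p, rfl⟩
    refine Real.sqrt_le_sqrt ?_
    have h1 : inner A (ξ + ξ <• d) (ξ + ξ <• d) = -d - d * d := by
      have h2 : inner A ξ ξ + inner A ξ ξ * d = -d := by
        rw [eq_neg_iff_add_eq_zero, ← hd]; abel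
      rw [PreHilbertModule.inner_add_left, inner_rsmul_left, PreHilbertModule.inner_add_right,
        inner_rsmul_right, hds, h2]
      noncomm_ring
    have h3 := p.1.map_sub_le (-d) (d * d)
    have h4 : p.1 (-d) = p.1 d := map_neg_eq_map p.1.toSeminorm d
    have h5 := hd2 p.1
    have h6 := p.1.mul_le d d
    have h7 := p.1.nonneg d
    rw [h1]
    nlinarith
  refine ⟨mk (ξ + ξ <• d) hbdd, inner A ξ ξ, ?_⟩
  rw [incl_mk, add_rsmul, ← rsmul_mul]
  -- This is `ξ = ξ (1 + d) (1 + x)`, which needs the quasi-inverse on the left of `x`; `hd'` is the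
  -- adjoint of `hd`.
  calc ξ = ξ + ξ <• (inner A ξ ξ + d + d * inner A ξ ξ) := by
          rw [hd']
          have h0 : ξ <• (0 : A) = 0 := by
            have h := rsmul_add ξ (0 : A) 0
            rw [add_zero] at h
            exact left_eq_add.1 h
          rw [h0, add_zero]
      _ = _ := by rw [rsmul_add, rsmul_add]; abel

/-- Factor `x - y = η (1 + b)`: then `⟨x - y, x - y⟩ = (1 + b)* ⟨η, x - y⟩`, which vanishes because
`η` is bounded. Testing against bounded vectors thus replaces any density argument. -/
lemma ext_inner_incl {x y : E}
    (h : ∀ ζ : BoundedVec A E, inner A (incl ζ) x = inner A (incl ζ) y) : x = y := by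
  rw [← sub_eq_zero, ← PreHilbertModule.inner_self_eq_zero (A := A)]
  obtain ⟨η, b, hη⟩ := exists_eq_add_rsmul (A := A) (x - y)
  have h1 : inner A (incl η) (x - y) = 0 := by
    rw [PreHilbertModule.inner_sub_right, h, sub_self]
  nth_rewrite 1 [hη]
  rw [PreHilbertModule.inner_add_left, PreHilbertModule.inner_rsmul_left, h1, mul_zero, add_zero]

end BoundedVec

namespace BoundedPart

variable {A : Type u} [ProCStarAlgebra A]

/-- Every element of `A` is of the form `a (1 + b)` with `a` bounded. -/
lemma exists_eq_add_mul (x : A) : ∃ (a : BoundedPart A) (b : A), x = incl a + incl a * b := by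
  -- Here `A` is viewed as a Hilbert module over itself, where the module seminorm of `x` is `p x`.
  obtain ⟨η, b, h⟩ := BoundedVec.exists_eq_add_rsmul (A := A) x
  refine ⟨mk (BoundedVec.incl η) ⟨‖η‖, ?_⟩, b, h⟩
  rintro _ ⟨p, rfl⟩
  have h1 := BoundedVec.le_norm p η
  rwa [ProCStarAlgebra.inner_def, p.1.star_mul_self, Real.sqrt_sq (p.1.nonneg _)] at h1

lemma ext_star_incl_mul {x y : A}
    (h : ∀ a : BoundedPart A, star (incl a) * x = star (incl a) * y) : x = y := by
  rw [← sub_eq_zero, ← PreHilbertModule.inner_self_eq_zero (A := A)]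
  obtain ⟨a, b, hab⟩ := exists_eq_add_mul (x - y)
  rw [ProCStarAlgebra.inner_def]
  nth_rewrite 1 [hab]
  rw [star_add, star_mul, add_mul, mul_assoc, mul_sub, h, sub_self, mul_zero, add_zero]

lemma tendsto_incl {ι : Type*} {l : Filter ι} {u : ι → BoundedPart A} {a : BoundedPart A}
    (h : Tendsto u l (𝓝 a)) : Tendsto (fun i => incl (u i)) l (𝓝 (incl a)) := by
  rw [ProCStarAlgebra.tendsto_iff]
  intro p
  rw [tendsto_iff_norm_sub_tendsto_zero] at h
  refine squeeze_zero (fun i => p.1.nonneg _) (fun i => ?_) h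
  rw [← map_sub]
  exact le_norm p _

end BoundedPart

/-! ### Extension of multipliers from `b(A)` to `A`. -/

namespace Multiplier

variable {A : Type u} {E : Type v} [ProCStarAlgebra A] [AddCommGroup E] [Module ℂ E]
  [UniformSpace E] [HilbertModule A E]

lemma Extends.unique {k k' : Multiplier A E} {h : Multiplier (BoundedPart A) (BoundedVec A E)}
    (hk : k.Extends h) (hk' : k'.Extends h) : k' = k := by
  refine AdjointableMap.ext fun x => ?_
  obtain ⟨a, b, rfl⟩ := BoundedPart.exists_eq_add_mul x
  refine (k'.map_add_rsmul _ b).trans (Eq.trans ?_ (k.map_add_rsmul _ b).symm)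
  rw [hk, hk']

lemma inner_incl (h : Multiplier (BoundedPart A) (BoundedVec A E)) (a : BoundedPart A)
    (ζ : BoundedVec A E) :
    inner A (BoundedVec.incl (h a)) (BoundedVec.incl ζ) =
      star (BoundedPart.incl a) * BoundedPart.incl (h.pairing ζ) := by
  rw [← BoundedVec.incl_inner, h.inner_map, ProCStarAlgebra.inner_def, map_mul, map_star]
  rfl

/-- The adjoint of an extension extends the adjoint: both sides have the same inner products with
bounded elements of `A`. -/
lemma Extends.pairing_incl {k : Multiplier A E}
    {h : Multiplier (BoundedPart A) (BoundedVec A E)} (hk : k.Extends h) (ζ : BoundedVec A E) :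
    k.pairing (BoundedVec.incl ζ) = BoundedPart.incl (h.pairing ζ) := by
  refine BoundedPart.ext_star_incl_mul fun a => ?_
  rw [← inner_incl, ← hk]
  exact (k.inner_map (BoundedPart.incl a) (BoundedVec.incl ζ)).symm

/-- The value at `x` of the extension of `h` to `A`, described by its inner products. -/
lemma exists_extension_apply (h : Multiplier (BoundedPart A) (BoundedVec A E)) (x : A) :
    ∃ v : E, ∀ ζ : BoundedVec A E,
      inner A (BoundedVec.incl ζ) v = star (BoundedPart.incl (h.pairing ζ)) * x := by
  obtain ⟨a, b, rfl⟩ := BoundedPart.exists_eq_add_mul x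
  -- The vector is `h(a) (1 + b)`. Its inner products with bounded vectors involve only `x = a (1 +
  -- b)`, so it is independent of the chosen factorisation.
  refine ⟨BoundedVec.incl (h a) + BoundedVec.incl (h a) <• b, fun ζ => ?_⟩
  rw [PreHilbertModule.inner_add_right, PreHilbertModule.inner_rsmul_right,
    ← PreHilbertModule.star_inner, inner_incl, star_mul, star_star, mul_add, mul_assoc]

/-- The value at `ξ` of the adjoint of the extension of `h`, described by its inner products. -/
lemma exists_extension_adjoint_apply (h : Multiplier (BoundedPart A) (BoundedVec A E)) (ξ : E) :
    ∃ x : A, ∀ a : BoundedPart A,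
      star (BoundedPart.incl a) * x = inner A (BoundedVec.incl (h a)) ξ := by
  obtain ⟨η, b, rfl⟩ := BoundedVec.exists_eq_add_rsmul (A := A) ξ
  refine ⟨BoundedPart.incl (h.pairing η) + BoundedPart.incl (h.pairing η) * b, fun a => ?_⟩
  rw [PreHilbertModule.inner_add_right, PreHilbertModule.inner_rsmul_right, inner_incl, mul_add,
    mul_assoc]

lemma exists_extends (h : Multiplier (BoundedPart A) (BoundedVec A E)) :
    ∃ k : Multiplier A E, k.Extends h := by
  -- The values of `T` and `S` are picked pointwise. Linearity over `ℂ` and `A` follows because the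
  -- expressions characterising them are linear and bounded elements separate points.
  choose T hT using exists_extension_apply h
  choose S hS using exists_extension_adjoint_apply h
  have hTincl : ∀ a : BoundedPart A, T (BoundedPart.incl a) = BoundedVec.incl (h a) := fun a =>
    BoundedVec.ext_inner_incl fun ζ => by
      rw [hT, ← PreHilbertModule.star_inner (BoundedVec.incl (h a)), inner_incl, star_mul,
        star_star]
  have hTmul : ∀ a b : A, T (a * b) = T a <• b := fun a b =>
    BoundedVec.ext_inner_incl fun ζ => by
      rw [PreHilbertModule.inner_rsmul_right, hT, hT, mul_assoc]
  have hTadd : ∀ a b : A, T (a + b) = T a + T b := fun a b =>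
    BoundedVec.ext_inner_incl (A := A) fun ζ => by
      rw [PreHilbertModule.inner_add_right, hT, hT, hT, mul_add]
  refine ⟨
    { toFun := T
      map_add' := hTadd
      map_smul' := fun c a => BoundedVec.ext_inner_incl (A := A) fun ζ => by
        rw [RingHom.id_apply, PreHilbertModule.inner_smul_right, hT, hT, mul_smul_comm]
      map_rsmul' := hTmul
      exists_adjoint' := ⟨
        { toFun := S
          map_add' := fun ξ η => BoundedPart.ext_star_incl_mul fun a => by
            rw [mul_add, hS, hS, hS, PreHilbertModule.inner_add_right]
          map_smul' := fun c ξ => BoundedPart.ext_star_incl_mul fun a => by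
            rw [RingHom.id_apply, mul_smul_comm, hS, hS, PreHilbertModule.inner_smul_right] },
        fun ξ a => BoundedPart.ext_star_incl_mul fun b => by
          rw [ProCStarAlgebra.rsmul_def, ← mul_assoc]
          change _ * S _ = _ * S _ * _
          rw [hS, hS, PreHilbertModule.inner_rsmul_right],
        fun x ξ => ?_⟩ }, hTincl⟩
  change inner A (T x) ξ = star x * S ξ
  -- For bounded `x` the adjoint relation is the defining property of `S`; `A`-linearity of `T`
  -- carries it over to `a (1 + b)`.
  obtain ⟨a, b, rfl⟩ := BoundedPart.exists_eq_add_mul x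
  rw [hTadd, hTmul, hTincl, PreHilbertModule.inner_add_left, PreHilbertModule.inner_rsmul_left,
    ← hS, star_add, star_mul, add_mul, mul_assoc]

end Multiplier

/-! ### Transfer of the frame property. -/

lemma IsStandardFrame.of_extends {A : Type u} {E : Type v} [ProCStarAlgebra A] [AddCommGroup E]
    [Module ℂ E] [UniformSpace E] [HilbertModule A E]
    {h : ℕ → Multiplier (BoundedPart A) (BoundedVec A E)} (hh : IsStandardFrame h)
    {k : ℕ → Multiplier A E} (hk : ∀ n, (k n).Extends (h n)) : IsStandardFrame k := by
  obtain ⟨S, hS, C, D, hC, hD, hCD⟩ := hh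
  have key : ∀ ξ : E, ∃ s : A,
      Tendsto (fun N => ∑ n ∈ Finset.range N, star ((k n).pairing ξ) * (k n).pairing ξ) atTop
        (𝓝 s) ∧
      CStarLE ((C : ℂ) • inner A ξ ξ) s ∧ CStarLE s ((D : ℂ) • inner A ξ ξ) := by
    intro ξ
    obtain ⟨η, b, rfl⟩ := BoundedVec.exists_eq_add_rsmul (A := A) ξ
    set s := BoundedPart.incl (S η) with hs
    have hsmul : ∀ c : ℂ, c • inner A (BoundedVec.incl η + BoundedVec.incl η <• b)
        (BoundedVec.incl η + BoundedVec.incl η <• b) =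
        BoundedPart.incl (c • inner (BoundedPart A) η η) +
          BoundedPart.incl (c • inner (BoundedPart A) η η) * b +
          star b * (BoundedPart.incl (c • inner (BoundedPart A) η η) +
          BoundedPart.incl (c • inner (BoundedPart A) η η) * b) := by
      intro c
      simp only [PreHilbertModule.inner_add_left, PreHilbertModule.inner_rsmul_left,
        PreHilbertModule.inner_add_right, PreHilbertModule.inner_rsmul_right, map_smul,
        BoundedVec.incl_inner, smul_add, smul_mul_assoc, mul_smul_comm,
        add_mul, mul_add, mul_assoc]
      abel
    have hpair : ∀ n, (k n).pairing (BoundedVec.incl η + BoundedVec.incl η <• b) =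
        BoundedPart.incl ((h n).pairing η) + BoundedPart.incl ((h n).pairing η) * b := by
      intro n
      rw [← (hk n).pairing_incl]
      exact (k n).adjoint.map_add_rsmul _ b
    -- The sum of the series at `ξ = η (1 + b)` is `(1 + b)* S(η) (1 + b)`. Norm convergence in
    -- `b(A)` implies convergence in `A`, and multiplication by a fixed element is continuous there.
    refine ⟨s + s * b + star b * (s + s * b), ?_, ?_, ?_⟩
    · have h1 := BoundedPart.tendsto_incl (hS η)
      have h2 := h1.add (ProCStarAlgebra.tendsto_mul_right b h1)
      refine (h2.add (ProCStarAlgebra.tendsto_mul_left (star b) h2)).congr fun N => ?_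
      simp only [hpair, map_sum, map_mul, map_star, Finset.sum_mul, Finset.mul_sum,
        ← Finset.sum_add_distrib, star_add, star_mul]
      refine Finset.sum_congr rfl fun n _ => ?_
      noncomm_ring
    · rw [hsmul]
      exact ((hCD η).1.map BoundedPart.incl).conj b
    · rw [hsmul]
      exact ((hCD η).2.map BoundedPart.incl).conj b
  choose s hs hsC hsD using key
  exact ⟨s, hs, C, D, hC, hD, fun ξ => ⟨hsC ξ, hsD ξ⟩⟩

theorem corollary3p13 {A E : Type*} [ProCStarAlgebra A] [AddCommGroup E] [Module ℂ E]
    [UniformSpace E] [HilbertModule A E] :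
    ((∃ h : ℕ → Multiplier (BoundedPart A) (BoundedVec A E), IsStandardFrame h) →
      ∃ k : ℕ → Multiplier A E, IsStandardFrame k) ∧
    ∀ h : ℕ → Multiplier (BoundedPart A) (BoundedVec A E), IsStandardFrame h →
      ∃ k : ℕ → Multiplier A E,
        (∀ n, (k n).Extends (h n) ∧ ∀ k' : Multiplier A E, k'.Extends (h n) → k' = k n) ∧
        IsStandardFrame k := by
  have key : ∀ h : ℕ → Multiplier (BoundedPart A) (BoundedVec A E), IsStandardFrame h →
      ∃ k : ℕ → Multiplier A E,
        (∀ n, (k n).Extends (h n) ∧ ∀ k' : Multiplier A E, k'.Extends (h n) → k' = k n) ∧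
        IsStandardFrame k := by
    intro h hh
    choose k hk using fun n => (h n).exists_extends
    exact ⟨k, fun n => ⟨hk n, fun k' hk' => (hk n).unique hk'⟩, hh.of_extends hk⟩
  refine ⟨?_, key⟩
  rintro ⟨h, hh⟩
  obtain ⟨k, -, hk⟩ := key h hh
  exact ⟨k, hk⟩
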